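/- Let $G=(V,E)$ be a finite connected simple graph with a vertex measure $\mu:V\to(0,\infty)$ and positive symmetric edge weights $w_{xy}=w_{yx}>0$, $xy\in E$, and let $$\Delta u(x)=\frac1{\mu(x)}\sum_{y\sim x}w_{xy}\,(u(y)-u(x))$$ be the Laplacian of a function $u:V\to\mathbb R$. Let $h_1,h_2:V\to(0,\infty)$ be two functions and $A,B>0$ two constants. On the space $L^\infty(V)$ of all functions $u:V\to\mathbb R$, with the norm $\|u\|_\infty=\max_V|u|$, consider the map $$\mathcal G_{h_1,h_2}(u)=-\Delta u+h_1e^{Au}(e^{Au}-1)+h_2e^{-Bu}(e^{-Bu}-1),$$ and let $B_R=\{u\in L^\infty(V):\|u\|_\infty<R\}$. Then there is a constant $L$ such that for every $R>L$ the Brouwer degree $\deg(\mathcal G_{h_1,h_2},B_R,0)$ is well defined (that is, $\mathcal G_{h_1,h_2}$ has no zero on $\partial B_R$) and $$\deg(\mathcal G_{h_1,h_2},B_R,0)=0 .$$ In particular $\lim_{R\to+\infty}\deg(\mathcal G_{h_1,h_2},B_R,0)=0$. -/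

import Mathlib

open scoped ContDiff

noncomputable section

section Degree

variable {ι : Type*} [Fintype ι]

/-- `p` is a regular value of `g` on `Ω`: the derivative of `g` is invertible at every point of `Ω`
that `g` sends to `p`. -/
def IsRegularValueOn (g : (ι → ℝ) → (ι → ℝ)) (Ω : Set (ι → ℝ)) (p : ι → ℝ) : Prop :=
  ∀ x ∈ Ω, g x = p → (fderiv ℝ g x).det ≠ 0

/-- The signed count `∑_{x ∈ Ω, g x = p} sgn det Dg(x)`. When `Ω` is bounded, `g` is smooth,
`p ∉ g (∂Ω)` and `p` is a regular value of `g` on `Ω`, this is a finite sum. -/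
def signedCount (g : (ι → ℝ) → (ι → ℝ)) (Ω : Set (ι → ℝ)) (p : ι → ℝ) : ℤ :=
  ∑ᶠ x ∈ {x | x ∈ Ω ∧ g x = p}, (SignType.sign (fderiv ℝ g x).det : ℤ)

/-- `g` is a smooth map that is uniformly closer to `f` on the closure of `Ω` than `p` is to
`f (∂Ω)`, and `p` is a regular value of `g` on `Ω`. -/
structure IsRegularApprox (f : (ι → ℝ) → (ι → ℝ)) (Ω : Set (ι → ℝ)) (p : ι → ℝ)
    (g : (ι → ℝ) → (ι → ℝ)) : Prop where
  smooth : ContDiff ℝ ∞ g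
  close : ∀ x ∈ closure Ω, ∀ y ∈ frontier Ω, dist (g x) (f x) < dist p (f y)
  regular : IsRegularValueOn g Ω p

/-- The Brouwer degree `deg(f, Ω, p)` is well defined and equals `d`: the set `Ω` is bounded and
open, `f` is continuous on the closure of `Ω`, `p ∉ f (∂Ω)`, and `d` is the common value of the
signed counts of the regular smooth approximations of `f`, of which there is at least one. -/
structure HasBrouwerDegree (f : (ι → ℝ) → (ι → ℝ)) (Ω : Set (ι → ℝ)) (p : ι → ℝ)
    (d : ℤ) : Prop where
  isOpen : IsOpen Ω
  isBounded : Bornology.IsBounded Ω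
  continuousOn : ContinuousOn f (closure Ω)
  notMem : p ∉ f '' frontier Ω
  exists_approx : ∃ g, IsRegularApprox f Ω p g
  count_eq : ∀ g, IsRegularApprox f Ω p g → signedCount g Ω p = d

theorem HasBrouwerDegree.unique {f : (ι → ℝ) → (ι → ℝ)} {Ω : Set (ι → ℝ)} {p : ι → ℝ}
    {d d' : ℤ}
    (h : HasBrouwerDegree f Ω p d) (h' : HasBrouwerDegree f Ω p d') : d = d' := by
  obtain ⟨g, hg⟩ := h.exists_approx
  rw [← h.count_eq g hg, h'.count_eq g hg]

end Degree

section Graph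

variable {V : Type*} [Fintype V] (G : SimpleGraph V) [DecidableRel G.Adj]

/-- The Laplacian of the graph `G` with vertex measure `μ` and edge weights `w`. -/
def graphLaplacian (μ : V → ℝ) (w : V → V → ℝ) (u : V → ℝ) (x : V) : ℝ :=
  (1 / μ x) * ∑ y ∈ G.neighborFinset x, w x y * (u y - u x)

/-- The map `u ↦ -Δu + h₁ e^{Au} (e^{Au} - 1) + h₂ e^{-Bu} (e^{-Bu} - 1)`. Functions on `V` carry
the maximum norm. -/
def tzitzeicaMap (μ : V → ℝ) (w : V → V → ℝ) (h₁ h₂ : V → ℝ) (A B : ℝ) (u : V → ℝ) : V → ℝ :=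
  fun x => -graphLaplacian G μ w u x
    + h₁ x * Real.exp (A * u x) * (Real.exp (A * u x) - 1)
    + h₂ x * Real.exp (-B * u x) * (Real.exp (-B * u x) - 1)

end Graph

end

/-! Summing `tzitzeicaMap` against `μ` kills the Laplacian, since `w` is symmetric. Each remaining
nonlinearity has the form `e^s (e^s - 1)`, which is at least `-1/4` everywhere and at least `s` for
`s ≥ 0`. When `‖u‖` is large, some vertex has `A u x` or `-B u x` large, and its term outweighs all
the negative contributions. So the functional `l v = ∑ μ x * v x` is positive on the image of every
large sphere (`exists_forall_sum_mul_tzitzeicaMap_pos`).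

Adding `T` times the constant function `1` then creates no zero on the sphere for `T ≥ 0`, and for
large `T` no zero is left in the ball, so the degree is `0`.

As the degree is defined by signed counts, homotopy invariance is obtained analytically. For a bump
`φ` near `0`, the integral of `φ(g) det Dg` is the signed count times `∫ φ`
(`exists_forall_integral_eq_signedCount_mul`), and by Stokes it does not change along a homotopy
keeping the sphere away from the support of `φ` (`integral_comp_mul_det_eq_of_homotopy`). -/

noncomputable section

/-! ### Pullbacks of top-degree forms are closed. -/

section Pullback

open MeasureTheory Set

variable {n : ℕ}

/-- The standard volume form on `Fin n → ℝ`. -/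
def volForm (n : ℕ) : (Fin n → ℝ) [⋀^Fin n]→L[ℝ] ℝ where
  toMultilinearMap := Matrix.detRowAlternating.toMultilinearMap
  cont := Continuous.matrix_det (continuous_id (X := Matrix (Fin n) (Fin n) ℝ))
  map_eq_zero_of_eq' := Matrix.detRowAlternating.map_eq_zero_of_eq'

theorem volForm_apply (v : Fin n → Fin n → ℝ) : volForm n v = (Pi.basisFun ℝ (Fin n)).det v := by
  rw [Pi.basisFun_det]
  rfl

theorem volForm_comp_single (L : (Fin n → ℝ) →L[ℝ] (Fin n → ℝ)) :
    volForm n (fun i => L (Pi.single i 1)) = L.det := by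
  have h := (Pi.basisFun ℝ (Fin n)).det_comp (L : (Fin n → ℝ) →ₗ[ℝ] (Fin n → ℝ))
    (Pi.basisFun ℝ (Fin n))
  rw [Module.Basis.det_self, mul_one] at h
  rw [volForm_apply, ContinuousLinearMap.det, ← h]
  congr 1
  ext i j
  simp

/-- The pullback under `F` of the top-degree form `φ dy₁ ∧ ⋯ ∧ dyₙ`. -/
def pullbackForm {E : Type*} [NormedAddCommGroup E] [NormedSpace ℝ E] (φ : (Fin n → ℝ) → ℝ)
    (F : E → Fin n → ℝ) (z : E) : E [⋀^Fin n]→L[ℝ] ℝ :=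
  (φ (F z) • volForm n).compContinuousLinearMap (fderiv ℝ F z)

variable {E : Type*} [NormedAddCommGroup E] [NormedSpace ℝ E] {φ : (Fin n → ℝ) → ℝ}
  {F : E → Fin n → ℝ}

theorem pullbackForm_apply (z : E) (v : Fin n → E) :
    pullbackForm φ F z v = φ (F z) * volForm n (fun i => fderiv ℝ F z (v i)) := rfl

/-- Exterior differentiation commutes with pullback, and `n + 1` vectors in an `n`-dimensional space
are dependent, so every `(n + 1)`-form there vanishes. -/
theorem extDeriv_pullbackForm (hφ : ContDiff ℝ 1 φ) (hF : ContDiff ℝ 2 F) (z : E) :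
    extDeriv (pullbackForm φ F) z = 0 := by
  have h := extDeriv_pullback (((hφ.differentiable one_ne_zero).smul_const (volForm n)) (F z))
    (hF.contDiffAt (x := z)) (by simp)
  unfold pullbackForm
  rw [h]
  ext v
  rw [ContinuousAlternatingMap.compContinuousLinearMap_apply]
  refine AlternatingMap.map_linearDependent
    (extDeriv (fun y => φ y • volForm n) (F z)).toAlternatingMap _ fun hli => ?_
  have := hli.fintype_card_le_finrank
  simp at this

theorem differentiable_pullbackForm (hφ : ContDiff ℝ 1 φ) (hF : ContDiff ℝ 2 F) :
    Differentiable ℝ (pullbackForm φ F) := by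
  have h1 : Differentiable ℝ fun z => φ (F z) • volForm n :=
    ((hφ.differentiable one_ne_zero).comp (hF.differentiable two_ne_zero)).smul_const _
  have h2 : Differentiable ℝ (fderiv ℝ F) :=
    (hF.fderiv_right (m := 1) (by norm_num)).differentiable one_ne_zero
  intro z
  exact (h1 z).continuousAlternatingMapCompContinuousLinearMap (h2 z)

end Pullback

/-! ### Stokes on a box. -/

section Divergence

open MeasureTheory Set

variable {n : ℕ} {φ : (Fin n → ℝ) → ℝ} {F : (Fin (n + 1) → ℝ) → Fin n → ℝ}

/-- The Stokes formula for the closed form `F^* (φ dy₁ ∧ ⋯ ∧ dyₙ)` on a box. -/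
theorem sum_integral_faces_pullbackForm_eq_zero (hφ : ContDiff ℝ 1 φ) (hF : ContDiff ℝ 2 F)
    {a b : Fin (n + 1) → ℝ} (hab : a ≤ b) :
    ∑ i : Fin (n + 1), (-1) ^ (i : ℕ) *
      ((∫ x in Icc (a ∘ i.succAbove) (b ∘ i.succAbove),
          pullbackForm φ F (i.insertNth (b i) x) (fun j => Pi.single (i.succAbove j) 1)) -
        ∫ x in Icc (a ∘ i.succAbove) (b ∘ i.succAbove),
          pullbackForm φ F (i.insertNth (a i) x) (fun j => Pi.single (i.succAbove j) 1)) = 0 := by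
  let η : Fin (n + 1) → (Fin (n + 1) → ℝ) → ℝ := fun i z =>
    (-1) ^ (i : ℕ) * pullbackForm φ F z (fun j => Pi.single (i.succAbove j) 1)
  have hd : ∀ i : Fin (n + 1), Differentiable ℝ fun z =>
      pullbackForm φ F z (fun j => Pi.single (i.succAbove j) 1) := fun i z =>
    (differentiable_pullbackForm hφ hF z).continuousAlternatingMap_apply_const _
  have hη : ∀ i, Differentiable ℝ (η i) := fun i => (hd i).const_mul _
  have hdiv : ∀ z, ∑ i, fderiv ℝ (η i) z (Pi.single i 1) = 0 := by
    intro z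
    have h := extDeriv_apply (differentiable_pullbackForm hφ hF z) (fun j => Pi.single j (1 : ℝ))
    rw [extDeriv_pullbackForm hφ hF z] at h
    refine Eq.trans ?_ h.symm
    refine Finset.sum_congr rfl fun i _ => ?_
    simp only [η]
    rw [fderiv_const_mul (hd i z)]
    simp
    rfl
  have key := integral_divergence_of_hasFDerivAt_off_countable' a b hab η
    (fun i z => fderiv ℝ (η i) z) ∅ countable_empty (fun i => (hη i).continuous.continuousOn)
    (fun z _ i => (hη i z).hasFDerivAt) (by simp [hdiv])
  simp only [hdiv, integral_zero] at key
  rw [key]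
  refine Finset.sum_congr rfl fun i _ => ?_
  simp only [η, integral_const_mul, mul_sub]

end Divergence

/-! ### Homotopy invariance of the degree integral. -/

section Homotopy

open MeasureTheory Set Metric

theorem pi_Icc_neg_eq_closedBall {ι : Type*} [Fintype ι] {R : ℝ} (hR : 0 ≤ R) :
    Icc (fun _ : ι => -R) (fun _ => R) = closedBall 0 R := by
  ext x
  rw [mem_closedBall_zero_iff, pi_norm_le_iff_of_nonneg hR]
  simp [Pi.le_def, abs_le, forall_and]

theorem norm_eq_of_forall_abs_le {ι : Type*} [Fintype ι] {R : ℝ} {x : ι → ℝ} (j : ι)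
    (hx : ∀ i, |x i| ≤ R) (hj : |x j| = R) : ‖x‖ = R := by
  refine le_antisymm ((pi_norm_le_iff_of_nonneg (hj ▸ abs_nonneg _)).2 hx) ?_
  rw [← hj]
  exact norm_le_pi_norm x j

variable {n : ℕ}

theorem hasFDerivAt_finCons_left_const (s : ℝ) (x : Fin n → ℝ) :
    HasFDerivAt (fun x : Fin n → ℝ => (Fin.cons s x : Fin (n + 1) → ℝ))
      (ContinuousLinearMap.pi (Fin.cons 0 fun i => ContinuousLinearMap.proj i) :
        (Fin n → ℝ) →L[ℝ] (Fin (n + 1) → ℝ)) x := by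
  refine hasFDerivAt_pi.2 fun i => ?_
  refine Fin.cases ?_ (fun j => ?_) i
  · simpa using hasFDerivAt_const s x
  · simpa using hasFDerivAt_apply j x

/-- On the slice `z₀ = s` the pullback form is the Jacobian density of the slice map. -/
theorem pullbackForm_cons_apply {φ : (Fin n → ℝ) → ℝ} {F : (Fin (n + 1) → ℝ) → Fin n → ℝ}
    (hF : Differentiable ℝ F) (s : ℝ) (x : Fin n → ℝ) :
    pullbackForm φ F (Fin.cons s x) (fun j => Pi.single j.succ 1) =
      φ (F (Fin.cons s x)) * (fderiv ℝ (fun x => F (Fin.cons s x)) x).det := by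
  have h := ((hF (Fin.cons s x)).hasFDerivAt.comp x (hasFDerivAt_finCons_left_const s x)).fderiv
  have h' : (fderiv ℝ (fun x : Fin n → ℝ => F (Fin.cons s x)) x) = _ := h
  rw [pullbackForm_apply, h', ← volForm_comp_single]
  congr 2
  ext1 j
  rw [ContinuousLinearMap.comp_apply]
  congr 1
  ext i
  refine Fin.cases ?_ (fun k => ?_) i
  · simp
  · simp [Pi.single_apply]

/-- In the maximum norm the closed ball is a cube, so Stokes applies to the homotopy `F` on `[0,1] ×
[-R,R]^n`. The lateral faces contribute nothing because `φ ∘ F` vanishes there; the faces `z 0 = 0`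
and `z 0 = 1` give the two integrals. -/
theorem integral_comp_mul_det_eq_of_homotopy_fin {g k : (Fin n → ℝ) → Fin n → ℝ}
    {φ : (Fin n → ℝ) → ℝ} (hg : ContDiff ℝ 2 g) (hk : ContDiff ℝ 2 k) (hφ : ContDiff ℝ 1 φ)
    {R : ℝ} (hR : 0 ≤ R)
    (H : ∀ x, ‖x‖ = R → ∀ t ∈ Icc (0 : ℝ) 1, φ ((1 - t) • g x + t • k x) = 0) :
    ∫ x in closedBall 0 R, φ (g x) * (fderiv ℝ g x).det =
      ∫ x in closedBall 0 R, φ (k x) * (fderiv ℝ k x).det := by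
  let F : (Fin (n + 1) → ℝ) → Fin n → ℝ := fun z =>
    (1 - z 0) • g (fun i => z i.succ) + z 0 • k (fun i => z i.succ)
  have htail : ContDiff ℝ 2 fun (z : Fin (n + 1) → ℝ) (i : Fin n) => z i.succ := by fun_prop
  have h0 : ContDiff ℝ 2 fun (z : Fin (n + 1) → ℝ) => z 0 := by fun_prop
  have hF : ContDiff ℝ 2 F :=
    ((contDiff_const.sub h0).smul (hg.comp htail)).add (h0.smul (hk.comp htail))
  let a : Fin (n + 1) → ℝ := Fin.cons 0 fun _ => -R
  let b : Fin (n + 1) → ℝ := Fin.cons 1 fun _ => R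
  have hab : a ≤ b := by
    intro i
    refine Fin.cases ?_ (fun j => ?_) i
    · simp [a, b]
    · simpa [a, b] using hR
  have hbd : ∀ z ∈ Icc a b, ∀ j : Fin n, |z j.succ| = R → φ (F z) = 0 := by
    intro z hz j hj
    have hz0 : z 0 ∈ Icc (0 : ℝ) 1 := ⟨hz.1 0, hz.2 0⟩
    refine H (fun i => z i.succ) (norm_eq_of_forall_abs_le j (fun i => ?_) hj) _ hz0
    exact abs_le.2 ⟨hz.1 i.succ, hz.2 i.succ⟩
  have key := sum_integral_faces_pullbackForm_eq_zero hφ hF hab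
  rw [Fin.sum_univ_succ, Finset.sum_eq_zero, add_zero] at key
  · have hIcc : Icc (a ∘ (0 : Fin (n + 1)).succAbove) (b ∘ (0 : Fin (n + 1)).succAbove) =
        closedBall (0 : Fin n → ℝ) R := by
      rw [← pi_Icc_neg_eq_closedBall hR]
      congr 1
    rw [hIcc] at key
    simp only [Fin.val_zero, pow_zero, one_mul, Fin.insertNth_zero', Fin.succAbove_zero,
      pullbackForm_cons_apply (hF.differentiable two_ne_zero)] at key
    simp only [a, b, F, Fin.cons_zero, Fin.cons_succ, sub_self, zero_smul, zero_add, one_smul,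
      sub_zero, add_zero] at key
    exact (sub_eq_zero.1 key).symm
  · intro j _
    rw [setIntegral_eq_zero_of_forall_eq_zero, setIntegral_eq_zero_of_forall_eq_zero, sub_self,
      mul_zero]
    · intro x hx
      rw [pullbackForm_apply, hbd _ (Fin.insertNth_mem_Icc.2 ⟨left_mem_Icc.2 (hab _), hx⟩) j,
        zero_mul]
      simp [a, abs_of_nonneg hR]
    · intro x hx
      rw [pullbackForm_apply, hbd _ (Fin.insertNth_mem_Icc.2 ⟨right_mem_Icc.2 (hab _), hx⟩) j,
        zero_mul]
      simp [b, abs_of_nonneg hR]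

/-- The integral `∫ φ(g) det Dg` over a ball is invariant under straight-line homotopies for which
`φ` vanishes along the boundary. -/
theorem integral_comp_mul_det_eq_of_homotopy {ι : Type*} [Fintype ι] {g k : (ι → ℝ) → ι → ℝ}
    {φ : (ι → ℝ) → ℝ} (hg : ContDiff ℝ 2 g) (hk : ContDiff ℝ 2 k) (hφ : ContDiff ℝ 1 φ)
    {R : ℝ} (hR : 0 ≤ R)
    (H : ∀ x, ‖x‖ = R → ∀ t ∈ Icc (0 : ℝ) 1, φ ((1 - t) • g x + t • k x) = 0) :
    ∫ x in closedBall 0 R, φ (g x) * (fderiv ℝ g x).det =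
      ∫ x in closedBall 0 R, φ (k x) * (fderiv ℝ k x).det := by
  let σ := (Fintype.equivFin ι).symm
  -- Reindexing coordinates is a measure-preserving isometry, and conjugation by it leaves
  -- determinants unchanged.
  let e : (Fin (Fintype.card ι) → ℝ) ≃ₗᵢ[ℝ] (ι → ℝ) :=
    { LinearEquiv.funCongrLeft ℝ ℝ σ.symm with
      norm_map' := fun x => le_antisymm
        ((pi_norm_le_iff_of_nonneg (norm_nonneg x)).2 fun i => norm_le_pi_norm x (σ.symm i))
        ((pi_norm_le_iff_of_nonneg (norm_nonneg _)).2 fun j => by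
          simpa using norm_le_pi_norm (LinearEquiv.funCongrLeft ℝ ℝ σ.symm x) (σ j)) }
  have hmp : MeasurePreserving e := by
    have he : ⇑e = MeasurableEquiv.piCongrLeft (fun _ => ℝ) σ := by
      funext x i
      obtain ⟨j, rfl⟩ := σ.surjective i
      rw [MeasurableEquiv.coe_piCongrLeft, Equiv.piCongrLeft_apply_apply]
      exact congrArg x (σ.symm_apply_apply j)
    rw [he]
    exact volume_measurePreserving_piCongrLeft (fun _ => ℝ) σ
  have hpre : e ⁻¹' closedBall 0 R = closedBall 0 R := by
    ext x; simp
  have htrans : ∀ f : (ι → ℝ) → ι → ℝ, ContDiff ℝ 2 f →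
      ∫ x in closedBall 0 R, φ (f x) * (fderiv ℝ f x).det =
        ∫ x in closedBall 0 R, φ (e (e.symm (f (e x)))) *
          (fderiv ℝ (fun x => e.symm (f (e x))) x).det := by
    intro f hf
    rw [← hmp.setIntegral_preimage_emb e.toHomeomorph.measurableEmbedding, hpre]
    congr 1
    ext x
    have hd : HasFDerivAt (fun x => e.symm (f (e x)))
        ((e.symm : (ι → ℝ) →L[ℝ] (Fin (Fintype.card ι) → ℝ)) ∘L (fderiv ℝ f (e x)) ∘L
          (e : (Fin (Fintype.card ι) → ℝ) →L[ℝ] (ι → ℝ))) x :=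
      (e.symm : (ι → ℝ) →L[ℝ] (Fin (Fintype.card ι) → ℝ)).hasFDerivAt.comp x
        (((hf.differentiable two_ne_zero) (e x)).hasFDerivAt.comp x
          (e : (Fin (Fintype.card ι) → ℝ) →L[ℝ] (ι → ℝ)).hasFDerivAt)
    rw [hd.fderiv, e.apply_symm_apply]
    congr 1
    exact (LinearMap.det_conj (fderiv ℝ f (e x) : (ι → ℝ) →ₗ[ℝ] (ι → ℝ))
      e.symm.toLinearEquiv).symm
  have hconj : ∀ f : (ι → ℝ) → ι → ℝ, ContDiff ℝ 2 f →
      ContDiff ℝ 2 (fun x => e.symm (f (e x))) := fun f hf =>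
    e.symm.contDiff.comp (hf.comp e.contDiff)
  rw [htrans g hg, htrans k hk]
  refine integral_comp_mul_det_eq_of_homotopy_fin (φ := fun y => φ (e y)) (hconj g hg) (hconj k hk)
    (hφ.comp e.contDiff) hR fun x hx t ht => ?_
  simpa using H (e x) (by simpa using hx) t ht

end Homotopy

/-! ### The degree integral as a signed count of zeros. -/

section Count

open MeasureTheory Set Metric Topology Filter

variable {ι : Type*} [Fintype ι] {g : (ι → ℝ) → ι → ℝ} {Ω : Set (ι → ℝ)}

theorem continuous_det_fderiv (hg : ContDiff ℝ ∞ g) : Continuous fun x => (fderiv ℝ g x).det :=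
  ContinuousLinearMap.continuous_det.comp (hg.continuous_fderiv (by simp))

theorem exists_isOpen_injOn_of_det_ne_zero (hg : ContDiff ℝ ∞ g) {x : ι → ℝ}
    (hx : (fderiv ℝ g x).det ≠ 0) {W : Set (ι → ℝ)} (hW : W ∈ 𝓝 x) :
    ∃ U ⊆ W, IsOpen U ∧ x ∈ U ∧ InjOn g U ∧
      (∀ y ∈ U, SignType.sign (fderiv ℝ g y).det = SignType.sign (fderiv ℝ g x).det) ∧
      g '' U ∈ 𝓝 (g x) := by
  have hs : HasStrictFDerivAt g
      (((fderiv ℝ g x).toContinuousLinearEquivOfDetNeZero hx : (ι → ℝ) ≃L[ℝ] (ι → ℝ)) :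
        (ι → ℝ) →L[ℝ] (ι → ℝ)) x := by
    rw [ContinuousLinearMap.coe_toContinuousLinearEquivOfDetNeZero]
    exact hg.contDiffAt.hasStrictFDerivAt (by simp)
  let P := hs.toOpenPartialHomeomorph g
  have hU : IsOpen {y | 0 < (fderiv ℝ g y).det * (fderiv ℝ g x).det} :=
    isOpen_lt continuous_const ((continuous_det_fderiv hg).mul continuous_const)
  have hxU : x ∈ (P.source ∩ interior W) ∩ {y | 0 < (fderiv ℝ g y).det * (fderiv ℝ g x).det} :=
    ⟨⟨hs.mem_toOpenPartialHomeomorph_source, mem_interior_iff_mem_nhds.2 hW⟩,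
      mul_self_pos.2 hx⟩
  have hopen := (P.open_source.inter (isOpen_interior (s := W))).inter hU
  refine ⟨_, fun y hy => interior_subset hy.1.2, hopen, hxU, fun y hy z hz h => ?_, ?_, ?_⟩
  · exact P.injOn hy.1.1 hz.1.1 h
  · intro y hy
    have hpos : 0 < (fderiv ℝ g y).det * (fderiv ℝ g x).det := hy.2
    rcases pos_and_pos_or_neg_and_neg_of_mul_pos hpos with h | h
    · rw [sign_pos h.1, sign_pos h.2]
    · rw [sign_neg h.1, sign_neg h.2]
  · rw [← hs.map_nhds_eq_of_equiv]
    exact image_mem_map (hopen.mem_nhds hxU)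

/-- The zeros form a compact set, as none lie on the frontier, and the inverse function theorem
isolates each of them. -/
theorem finite_zeros_of_isRegularValueOn (hg : ContDiff ℝ ∞ g) (hb : Bornology.IsBounded Ω)
    (hΩ : IsOpen Ω) (h0 : ∀ x ∈ frontier Ω, g x ≠ 0) (hreg : IsRegularValueOn g Ω 0) :
    {x | x ∈ Ω ∧ g x = 0}.Finite := by
  have hZ : {x | x ∈ Ω ∧ g x = 0} = closure Ω ∩ g ⁻¹' {0} := by
    ext x
    refine ⟨fun h => ⟨subset_closure h.1, h.2⟩, fun h => ⟨?_, h.2⟩⟩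
    by_contra hx
    exact h0 x (by rw [hΩ.frontier_eq]; exact ⟨h.1, hx⟩) h.2
  have hcomp : IsCompact {x | x ∈ Ω ∧ g x = 0} := by
    rw [hZ]
    exact hb.isCompact_closure.inter_right (isClosed_singleton.preimage hg.continuous)
  have hloc : ∀ x ∈ {x | x ∈ Ω ∧ g x = 0}, ∃ U ∈ 𝓝 x, InjOn g U := by
    intro x hx
    obtain ⟨U, -, hU, hxU, hinj, -⟩ :=
      exists_isOpen_injOn_of_det_ne_zero hg (hreg x hx.1 hx.2) univ_mem
    exact ⟨U, hU.mem_nhds hxU, hinj⟩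
  choose! U hU hinj using hloc
  obtain ⟨t, ht, hcover⟩ := hcomp.elim_nhds_subcover U hU
  refine t.finite_toSet.subset fun x hx => ?_
  obtain ⟨y, hy, hxy⟩ := mem_iUnion₂.1 (hcover hx)
  have : x = y := hinj y (ht y hy) hxy (mem_of_mem_nhds (hU y (ht y hy)))
    (hx.2.trans (ht y hy).2.symm)
  exact this ▸ hy

theorem integral_comp_mul_det_eq_sign_mul (hg : ContDiff ℝ ∞ g) {φ : (ι → ℝ) → ℝ} {x : ι → ℝ}
    {U : Set (ι → ℝ)} (hU : IsOpen U) (hinj : InjOn g U)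
    (hsign : ∀ y ∈ U, SignType.sign (fderiv ℝ g y).det = SignType.sign (fderiv ℝ g x).det)
    (hφ : ∀ y, φ y ≠ 0 → y ∈ g '' U) :
    ∫ y in U, φ (g y) * (fderiv ℝ g y).det =
      ((SignType.sign (fderiv ℝ g x).det : ℤ) : ℝ) * ∫ y, φ y := by
  have h1 := integral_image_eq_integral_abs_det_fderiv_smul volume hU.measurableSet
    (fun y _ => ((hg.differentiable (by simp)) y).hasFDerivAt.hasFDerivWithinAt) hinj φ
  rw [setIntegral_eq_integral_of_forall_compl_eq_zero fun y hy => not_not.1 (mt (hφ y) hy)] at h1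
  rw [h1, ← integral_const_mul]
  refine setIntegral_congr_fun hU.measurableSet fun y hy => ?_
  have h2 : ((SignType.sign (fderiv ℝ g x).det : ℤ) : ℝ) * |(fderiv ℝ g y).det| =
      (fderiv ℝ g y).det := by
    rw [← hsign y hy]
    simp
  simp only [smul_eq_mul]
  rw [← mul_assoc, h2, mul_comm]

/-- The integral formula for the degree at a regular value. -/
theorem exists_forall_integral_eq_signedCount_mul (hg : ContDiff ℝ ∞ g)
    (hb : Bornology.IsBounded Ω) (hΩ : IsOpen Ω) (h0 : ∀ x ∈ frontier Ω, g x ≠ 0)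
    (hreg : IsRegularValueOn g Ω 0) :
    ∃ ε > 0, ∀ φ : (ι → ℝ) → ℝ, Continuous φ → (∀ y, φ y ≠ 0 → ‖y‖ < ε) →
      ∫ x in Ω, φ (g x) * (fderiv ℝ g x).det = (signedCount g Ω 0 : ℝ) * ∫ y, φ y := by
  have hfin := finite_zeros_of_isRegularValueOn hg hb hΩ h0 hreg
  obtain ⟨S, hS, hdisj⟩ := hfin.t2_separation
  have hloc : ∀ x ∈ {x | x ∈ Ω ∧ g x = 0}, ∃ U ⊆ Ω ∩ S x, IsOpen U ∧ x ∈ U ∧ InjOn g U ∧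
      (∀ y ∈ U, SignType.sign (fderiv ℝ g y).det = SignType.sign (fderiv ℝ g x).det) ∧
      g '' U ∈ 𝓝 (g x) := fun x hx =>
    exists_isOpen_injOn_of_det_ne_zero hg (hreg x hx.1 hx.2)
      (inter_mem (hΩ.mem_nhds hx.1) ((hS x).2.mem_nhds (hS x).1))
  choose! U hUsub hUo hxU hinj hsign himg using hloc
  have hUnion : IsOpen (⋃ x ∈ {x | x ∈ Ω ∧ g x = 0}, U x) := isOpen_biUnion hUo
  have hC : IsCompact (closure Ω \ ⋃ x ∈ {x | x ∈ Ω ∧ g x = 0}, U x) :=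
    hb.isCompact_closure.diff hUnion
  have h0C : (0 : ι → ℝ) ∉ g '' (closure Ω \ ⋃ x ∈ {x | x ∈ Ω ∧ g x = 0}, U x) := by
    rintro ⟨x, ⟨hx, hxn⟩, hgx⟩
    by_cases hxΩ : x ∈ Ω
    · exact hxn (mem_biUnion (show x ∈ {x | x ∈ Ω ∧ g x = 0} from ⟨hxΩ, hgx⟩)
        (hxU x ⟨hxΩ, hgx⟩))
    · exact h0 x (by rw [hΩ.frontier_eq]; exact ⟨hx, hxΩ⟩) hgx
  -- A small ball around `0` misses the image of what lies outside the chosen neighbourhoods and is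
  -- covered by the image of each of them.
  have hnhds : (g '' (closure Ω \ ⋃ x ∈ {x | x ∈ Ω ∧ g x = 0}, U x))ᶜ ∩
      ⋂ x ∈ {x | x ∈ Ω ∧ g x = 0}, g '' U x ∈ 𝓝 (0 : ι → ℝ) := by
    refine inter_mem ((hC.image hg.continuous).isClosed.isOpen_compl.mem_nhds h0C)
      ((biInter_mem hfin).2 fun x hx => ?_)
    have := himg x hx
    rwa [hx.2] at this
  obtain ⟨ε, hε, hball⟩ := Metric.mem_nhds_iff.1 hnhds
  refine ⟨ε, hε, fun φ hφc hφ => ?_⟩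
  have hφ' : ∀ y, φ y ≠ 0 → y ∈ (g '' (closure Ω \ ⋃ x ∈ {x | x ∈ Ω ∧ g x = 0}, U x))ᶜ ∩
      ⋂ x ∈ {x | x ∈ Ω ∧ g x = 0}, g '' U x := fun y hy =>
    hball (mem_ball_zero_iff.2 (hφ y hy))
  have hcont : Continuous fun x => φ (g x) * (fderiv ℝ g x).det :=
    (hφc.comp hg.continuous).mul (continuous_det_fderiv hg)
  have hsubΩ : (⋃ x ∈ hfin.toFinset, U x) ⊆ Ω :=
    iUnion₂_subset fun x hx => (hUsub x (hfin.mem_toFinset.1 hx)).trans inter_subset_left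
  have hint : IntegrableOn (fun x => φ (g x) * (fderiv ℝ g x).det) (closure Ω) :=
    hcont.continuousOn.integrableOn_compact hb.isCompact_closure
  have hset : (⋃ x ∈ hfin.toFinset, U x) = ⋃ x ∈ {x | x ∈ Ω ∧ g x = 0}, U x := by simp
  rw [setIntegral_eq_of_subset_of_forall_sdiff_eq_zero hΩ.measurableSet hsubΩ,
    integral_biUnion_finset, signedCount, finsum_mem_eq_finite_toFinset_sum _ hfin, Int.cast_sum,
    Finset.sum_mul]
  · refine Finset.sum_congr rfl fun x hx => ?_
    have hx' := hfin.mem_toFinset.1 hx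
    exact integral_comp_mul_det_eq_sign_mul hg (hUo x hx') (hinj x hx') (hsign x hx')
      fun y hy => mem_iInter₂.1 (hφ' y hy).2 x hx'
  · exact fun x hx => (hUo x (hfin.mem_toFinset.1 hx)).measurableSet
  · intro x hx y hy hxy
    rw [hfin.coe_toFinset] at hx hy
    exact (hdisj hx hy hxy).mono ((hUsub x hx).trans inter_subset_right)
      ((hUsub y hy).trans inter_subset_right)
  · exact fun x hx => hint.mono_set
      (((hUsub x (hfin.mem_toFinset.1 hx)).trans inter_subset_left).trans subset_closure)
  · intro x hx
    rw [hset] at hx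
    have : φ (g x) = 0 := by
      by_contra h
      exact (hφ' _ h).1 ⟨x, ⟨subset_closure hx.1, hx.2⟩, rfl⟩
    rw [this, zero_mul]

end Count

/-! ### Vanishing of the degree when a functional is positive on the image of the sphere. -/

section DegreeZero

open MeasureTheory Set Metric Topology Filter

variable {ι : Type*} [Fintype ι] {f : (ι → ℝ) → ι → ℝ} {R : ℝ}

/-- By Sard the critical values form a null set, which cannot contain a ball. -/
theorem exists_norm_lt_forall_det_ne_zero (hf : ContDiff ℝ ∞ f) {δ : ℝ} (hδ : 0 < δ) :
    ∃ q : ι → ℝ, ‖q‖ < δ ∧ ∀ x, f x = q → (fderiv ℝ f x).det ≠ 0 := by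
  have hnull : volume (f '' {x | (fderiv ℝ f x).det = 0}) = 0 :=
    addHaar_image_eq_zero_of_det_fderivWithin_eq_zero volume
      (fun x _ => ((hf.differentiable (by simp)) x).hasFDerivAt.hasFDerivWithinAt) fun x hx => hx
  obtain ⟨q, hq, hqn⟩ : ∃ q ∈ ball (0 : ι → ℝ) δ, q ∉ f '' {x | (fderiv ℝ f x).det = 0} := by
    by_contra! h
    exact (measure_ball_pos volume (0 : ι → ℝ) hδ).ne' (measure_mono_null h hnull)
  exact ⟨q, mem_ball_zero_iff.1 hq, fun x hx hdet => hqn ⟨x, hdet, hx⟩⟩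

theorem exists_isRegularApprox_of_ne_zero (hf : ContDiff ℝ ∞ f) (hR : R ≠ 0)
    (h0 : ∀ x, ‖x‖ = R → f x ≠ 0) : ∃ g, IsRegularApprox f (ball 0 R) 0 g := by
  obtain ⟨δ, hδ, hδf⟩ := (isCompact_sphere (0 : ι → ℝ) R).exists_forall_le'
    (f := fun x => ‖f x‖) hf.continuous.norm.continuousOn (a := 0)
    fun x hx => norm_pos_iff.2 (h0 x (mem_sphere_zero_iff_norm.1 hx))
  obtain ⟨q, hq, hreg⟩ := exists_norm_lt_forall_det_ne_zero hf hδ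
  refine ⟨fun x => f x - q, hf.sub contDiff_const, fun x _ y hy => ?_, fun x _ hx => ?_⟩
  · rw [frontier_ball _ hR] at hy
    rw [dist_eq_norm, dist_zero_left, sub_sub_cancel_left, norm_neg]
    exact hq.trans_le (hδf y hy)
  · rw [fderiv_sub_const]
    exact hreg x (sub_eq_zero.1 hx)

/-- Translating `f` along `v` only increases `l`, so `φ` stays zero on the sphere; after a long
enough translation the whole ball lands in `c ≤ l y`, where `φ = 0`. -/
theorem integral_eq_zero_of_pos_on_sphere (hf : ContDiff ℝ 2 f) (hR : 0 ≤ R)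
    (l : (ι → ℝ) →L[ℝ] ℝ) {v : ι → ℝ} (hv : 0 < l v) {c : ℝ}
    (hpos : ∀ x, ‖x‖ = R → c ≤ l (f x)) {φ : (ι → ℝ) → ℝ} (hφ : ContDiff ℝ 1 φ)
    (hφc : ∀ y, c ≤ l y → φ y = 0) :
    ∫ x in closedBall 0 R, φ (f x) * (fderiv ℝ f x).det = 0 := by
  obtain ⟨m, hm⟩ := (isCompact_closedBall (0 : ι → ℝ) R).bddBelow_image
    (l.continuous.comp hf.continuous).continuousOn
  obtain ⟨T, hT0, hT⟩ : ∃ T, 0 ≤ T ∧ c ≤ m + T * l v := by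
    refine ⟨|c - m| / l v, by positivity, ?_⟩
    rw [div_mul_cancel₀ _ hv.ne']
    linarith [le_abs_self (c - m)]
  rw [integral_comp_mul_det_eq_of_homotopy hf (k := fun x => f x + T • v)
    (hf.add contDiff_const) hφ hR]
  · refine setIntegral_eq_zero_of_forall_eq_zero fun x hx => ?_
    rw [hφc _, zero_mul]
    rw [map_add, map_smul, smul_eq_mul]
    have : m ≤ l (f x) := hm ⟨x, hx, rfl⟩
    linarith
  · intro x hx t ht
    refine hφc _ ?_
    have h1 : l ((1 - t) • f x + t • (f x + T • v)) = l (f x) + t * (T * l v) := by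
      simp only [map_add, map_smul, smul_eq_mul]
      ring
    rw [h1]
    have := mul_nonneg ht.1 (mul_nonneg hT0 hv.le)
    linarith [hpos x hx]

/-- If some linear functional is positive on `f (∂B_R)`, then the degree of `f` on `B_R` at `0`
vanishes: the value `0` can be moved to infinity without meeting `f (∂B_R)`. -/
theorem hasBrouwerDegree_zero_of_pos_on_sphere (hf : ContDiff ℝ ∞ f) (hR : 0 < R)
    (l : (ι → ℝ) →L[ℝ] ℝ) {v : ι → ℝ} (hv : 0 < l v) (hpos : ∀ x, ‖x‖ = R → 0 < l (f x)) :
    HasBrouwerDegree f (ball 0 R) 0 0 := by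
  have hne : ∀ x, ‖x‖ = R → f x ≠ 0 := fun x hx h => by simpa [h] using hpos x hx
  have hfr : frontier (ball (0 : ι → ℝ) R) = sphere 0 R := frontier_ball _ hR.ne'
  refine ⟨isOpen_ball, isBounded_ball, hf.continuous.continuousOn, ?_,
    exists_isRegularApprox_of_ne_zero hf hR.ne' hne, fun g hg => ?_⟩
  · rw [hfr]
    rintro ⟨x, hx, hfx⟩
    exact hne x (mem_sphere_zero_iff_norm.1 hx) hfx
  have hclose : ∀ x ∈ sphere (0 : ι → ℝ) R, 0 < ‖f x‖ - ‖g x - f x‖ := by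
    intro x hx
    have h := hg.close x (by rw [closure_ball _ hR.ne']; exact sphere_subset_closedBall hx) x
      (by rwa [hfr])
    rw [dist_eq_norm, dist_zero_left] at h
    linarith
  obtain ⟨ε₁, hε₁, hε₁g⟩ := (isCompact_sphere (0 : ι → ℝ) R).exists_forall_le'
    (f := fun x => ‖f x‖ - ‖g x - f x‖)
    (hf.continuous.norm.sub (hg.smooth.continuous.sub hf.continuous).norm).continuousOn hclose
  obtain ⟨ε₂, hε₂, hε₂f⟩ := (isCompact_sphere (0 : ι → ℝ) R).exists_forall_le'
    (l.continuous.comp hf.continuous).continuousOn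
    fun x hx => hpos x (mem_sphere_zero_iff_norm.1 hx)
  have hg0 : ∀ x ∈ frontier (ball (0 : ι → ℝ) R), g x ≠ 0 := by
    intro x hx h
    have := hclose x (by rwa [hfr] at hx)
    rw [h, zero_sub, norm_neg, sub_self] at this
    exact lt_irrefl _ this
  obtain ⟨ε₃, hε₃, hcount⟩ := exists_forall_integral_eq_signedCount_mul hg.smooth isBounded_ball
    isOpen_ball hg0 hg.regular
  -- The three bounds serve, in order, the homotopy from `g` to `f` on the sphere, the vanishing of
  -- `φ` where `ε₂ ≤ l y`, and the count formula.
  obtain ⟨ε, hε, hεε₁, hεε₂, hεε₃⟩ : ∃ ε > 0, ε ≤ ε₁ ∧ ‖l‖ * ε < ε₂ ∧ ε ≤ ε₃ := by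
    have hl : 0 < ‖l‖ + 1 := by positivity
    refine ⟨min (min ε₁ (ε₂ / (‖l‖ + 1))) ε₃, by positivity,
      (min_le_left _ _).trans (min_le_left _ _), ?_, min_le_right _ _⟩
    calc ‖l‖ * min (min ε₁ (ε₂ / (‖l‖ + 1))) ε₃ ≤ ‖l‖ * (ε₂ / (‖l‖ + 1)) := by
          gcongr
          exact (min_le_left _ _).trans (min_le_right _ _)
      _ < (‖l‖ + 1) * (ε₂ / (‖l‖ + 1)) := by gcongr; linarith
      _ = ε₂ := mul_div_cancel₀ _ hl.ne'
  let φ : ContDiffBump (0 : ι → ℝ) := ⟨ε / 2, ε, half_pos hε, half_lt_self hε⟩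
  have hφ : ∀ y, φ y ≠ 0 → ‖y‖ < ε := by
    intro y hy
    have : y ∈ Function.support φ := hy
    rw [φ.support_eq] at this
    exact mem_ball_zero_iff.1 this
  have hφ1 : ContDiff ℝ 1 φ := φ.contDiff
  have h1 : ∫ x in ball 0 R, φ (g x) * (fderiv ℝ g x).det =
      ∫ x in closedBall 0 R, φ (g x) * (fderiv ℝ g x).det := by
    refine (setIntegral_eq_of_subset_of_forall_sdiff_eq_zero measurableSet_closedBall
      ball_subset_closedBall fun x hx => ?_).symm
    have hxs : x ∈ sphere (0 : ι → ℝ) R := by rwa [closedBall_sdiff_ball] at hx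
    have : φ (g x) = 0 := by
      by_contra h
      have h2 := hφ _ h
      have h3 := hε₁g x hxs
      have h4 := norm_sub_norm_le (f x) (f x - g x)
      rw [sub_sub_cancel, norm_sub_rev] at h4
      linarith
    rw [this, zero_mul]
  have h2 : ∫ x in closedBall 0 R, φ (g x) * (fderiv ℝ g x).det =
      ∫ x in closedBall 0 R, φ (f x) * (fderiv ℝ f x).det := by
    refine integral_comp_mul_det_eq_of_homotopy (contDiff_infty.1 hg.smooth 2)
      (contDiff_infty.1 hf 2) hφ1 hR.le fun x hx t ht => ?_
    by_contra h
    have h3 := hφ _ h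
    have h4 := hε₁g x (mem_sphere_zero_iff_norm.2 hx)
    have h5 : f x = ((1 - t) • g x + t • f x) - (1 - t) • (g x - f x) := by module
    have h6 : ‖f x‖ ≤ ‖(1 - t) • g x + t • f x‖ + ‖(1 - t) • (g x - f x)‖ := by
      conv_lhs => rw [h5]
      exact norm_sub_le _ _
    have h7 : ‖(1 - t) • (g x - f x)‖ ≤ ‖g x - f x‖ := by
      rw [norm_smul, Real.norm_of_nonneg (by linarith [ht.2])]
      exact mul_le_of_le_one_left (norm_nonneg _) (by linarith [ht.1])
    linarith
  have h3 : ∫ x in closedBall 0 R, φ (f x) * (fderiv ℝ f x).det = 0 := by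
    refine integral_eq_zero_of_pos_on_sphere (contDiff_infty.1 hf 2) hR.le l hv
      (fun x hx => hε₂f x (mem_sphere_zero_iff_norm.2 hx)) hφ1 fun y hy => ?_
    by_contra h
    have h4 := (le_abs_self _).trans (l.le_opNorm y)
    have h5 := mul_le_mul_of_nonneg_left (hφ y h).le (norm_nonneg l)
    linarith
  have h4 := hcount φ φ.continuous fun y hy => (hφ y hy).trans_le hεε₃
  rw [h1, h2, h3] at h4
  have h5 : 0 < ∫ y, φ y := φ.integral_pos
  exact_mod_cast (mul_eq_zero.1 h4.symm).resolve_right h5.ne'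

end DegreeZero

/-! ### Positivity of the weighted sum for large `u`. -/

section Tzitzeica

variable {V : Type*} [Fintype V] (G : SimpleGraph V) [DecidableRel G.Adj] {μ : V → ℝ}
  {w : V → V → ℝ} {h₁ h₂ : V → ℝ} {A B : ℝ}

/-- The summand is antisymmetric in `x` and `y`, so the double sum equals its own negative. -/
theorem sum_mul_graphLaplacian (hμ : ∀ x, μ x ≠ 0) (hw : ∀ x y, G.Adj x y → w x y = w y x)
    (u : V → ℝ) : ∑ x, μ x * graphLaplacian G μ w u x = 0 := by
  have h1 : ∀ x, μ x * graphLaplacian G μ w u x =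
      ∑ y, if G.Adj x y then w x y * (u y - u x) else 0 := by
    intro x
    rw [graphLaplacian, ← mul_assoc, mul_one_div_cancel (hμ x), one_mul, ← Finset.sum_filter]
    refine Finset.sum_congr ?_ fun _ _ => rfl
    ext y
    simp
  simp only [h1]
  have h2 : ∑ x, ∑ y, (if G.Adj x y then w x y * (u y - u x) else 0) =
      -∑ x, ∑ y, (if G.Adj x y then w x y * (u y - u x) else 0) := by
    conv_lhs => rw [Finset.sum_comm]
    simp only [← Finset.sum_neg_distrib]
    refine Finset.sum_congr rfl fun x _ => Finset.sum_congr rfl fun y _ => ?_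
    by_cases h : G.Adj x y
    · rw [if_pos h, if_pos h.symm, hw x y h]
      ring
    · rw [if_neg h, if_neg fun h' => h h'.symm, neg_zero]
  linarith

theorem contDiff_tzitzeicaMap : ContDiff ℝ ∞ (tzitzeicaMap G μ w h₁ h₂ A B) := by
  refine contDiff_pi.2 fun x => ?_
  unfold tzitzeicaMap graphLaplacian
  fun_prop

theorem neg_quarter_le_exp_mul_exp_sub_one (t : ℝ) :
    -(1 / 4) ≤ Real.exp t * (Real.exp t - 1) := by
  nlinarith [sq_nonneg (Real.exp t - 1 / 2)]

theorem le_exp_mul_exp_sub_one {t : ℝ} (ht : 0 ≤ t) : t ≤ Real.exp t * (Real.exp t - 1) := by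
  nlinarith [Real.add_one_le_exp t]

theorem sum_mul_tzitzeicaMap (hμ : ∀ x, μ x ≠ 0) (hw : ∀ x y, G.Adj x y → w x y = w y x)
    (u : V → ℝ) : ∑ x, μ x * tzitzeicaMap G μ w h₁ h₂ A B u x =
      ∑ x, μ x * (h₁ x * (Real.exp (A * u x) * (Real.exp (A * u x) - 1)) +
        h₂ x * (Real.exp (-B * u x) * (Real.exp (-B * u x) - 1))) := by
  rw [← sub_eq_zero, ← Finset.sum_sub_distrib, ← neg_eq_zero, ← Finset.sum_neg_distrib,
    ← sum_mul_graphLaplacian G hμ hw u]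
  refine Finset.sum_congr rfl fun x _ => ?_
  rw [tzitzeicaMap]
  ring

theorem exists_forall_sum_mul_tzitzeicaMap_pos (hμ : ∀ x, 0 < μ x)
    (hw : ∀ x y, G.Adj x y → w x y = w y x) (hh₁ : ∀ x, 0 < h₁ x) (hh₂ : ∀ x, 0 < h₂ x)
    (hA : 0 < A) (hB : 0 < B) :
    ∃ L : ℝ, 0 ≤ L ∧ ∀ u : V → ℝ, L < ‖u‖ →
      0 < ∑ x, μ x * tzitzeicaMap G μ w h₁ h₂ A B u x := by
  -- `C` is the largest total deficit that the bounds `-1/4` allow. Beyond `r x`, the linear lower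
  -- bound at the single vertex `x` already exceeds `C`, whatever the sign of `u x`.
  let C : ℝ := ∑ x, μ x * (h₁ x + h₂ x) / 4
  have hC : 0 ≤ C := Finset.sum_nonneg fun x _ => by
    have := hμ x; have := hh₁ x; have := hh₂ x; positivity
  let r : V → ℝ := fun x => C / (μ x * h₁ x * A) + C / (μ x * h₂ x * B)
  have hr : ∀ x, 0 ≤ r x := fun x => by
    have := hμ x; have := hh₁ x; have := hh₂ x; positivity
  refine ⟨∑ x, r x, Finset.sum_nonneg fun x _ => hr x, fun u hu => ?_⟩
  have hL : 0 ≤ ∑ x, r x := Finset.sum_nonneg fun x _ => hr x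
  obtain ⟨x₀, hx₀⟩ : ∃ x₀, ∑ x, r x < |u x₀| := by
    by_contra! h
    exact hu.not_ge ((pi_norm_le_iff_of_nonneg hL).2 h)
  have hrx : r x₀ < |u x₀| :=
    (Finset.single_le_sum (fun x _ => hr x) (Finset.mem_univ x₀)).trans_lt hx₀
  have hμ₀ := hμ x₀
  have ha := hh₁ x₀
  have hb := hh₂ x₀
  rw [sum_mul_tzitzeicaMap G (fun x => (hμ x).ne') hw]
  set p : V → ℝ := fun x => Real.exp (A * u x) * (Real.exp (A * u x) - 1)
  set q : V → ℝ := fun x => Real.exp (-B * u x) * (Real.exp (-B * u x) - 1)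
  have hp4 : ∀ x, -(1 / 4) ≤ p x := fun x => neg_quarter_le_exp_mul_exp_sub_one _
  have hq4 : ∀ x, -(1 / 4) ≤ q x := fun x => neg_quarter_le_exp_mul_exp_sub_one _
  have hshift : ∑ x, μ x * (h₁ x * p x + h₂ x * q x) =
      ∑ x, μ x * (h₁ x * (p x + 1 / 4) + h₂ x * (q x + 1 / 4)) - C := by
    rw [← Finset.sum_sub_distrib]
    exact Finset.sum_congr rfl fun x _ => by ring
  have hterm : ∀ x, 0 ≤ μ x * (h₁ x * (p x + 1 / 4) + h₂ x * (q x + 1 / 4)) := fun x =>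
    mul_nonneg (hμ x).le (add_nonneg (mul_nonneg (hh₁ x).le (by linarith [hp4 x]))
      (mul_nonneg (hh₂ x).le (by linarith [hq4 x])))
  have hle := Finset.single_le_sum (fun x _ => hterm x) (Finset.mem_univ x₀)
  change 0 < ∑ x, μ x * (h₁ x * p x + h₂ x * q x)
  rw [hshift]
  suffices h : C < μ x₀ * (h₁ x₀ * (p x₀ + 1 / 4) + h₂ x₀ * (q x₀ + 1 / 4)) by linarith
  have hc₁ : 0 ≤ C / (μ x₀ * h₁ x₀ * A) := by positivity
  have hc₂ : 0 ≤ C / (μ x₀ * h₂ x₀ * B) := by positivity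
  have hp0 : 0 ≤ h₁ x₀ * (p x₀ + 1 / 4) := mul_nonneg ha.le (by linarith [hp4 x₀])
  have hq0 : 0 ≤ h₂ x₀ * (q x₀ + 1 / 4) := mul_nonneg hb.le (by linarith [hq4 x₀])
  rcases le_total 0 (u x₀) with hs | hs
  · rw [abs_of_nonneg hs] at hrx
    have h3 : C / (μ x₀ * h₁ x₀ * A) < u x₀ := by simp only [r] at hrx; linarith
    rw [div_lt_iff₀ (by positivity)] at h3
    have h4 : A * u x₀ ≤ p x₀ := le_exp_mul_exp_sub_one (by positivity)
    calc C < u x₀ * (μ x₀ * h₁ x₀ * A) := h3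
      _ = μ x₀ * (h₁ x₀ * (A * u x₀)) := by ring
      _ ≤ μ x₀ * (h₁ x₀ * (p x₀ + 1 / 4) + h₂ x₀ * (q x₀ + 1 / 4)) := by
        gcongr
        have := mul_le_mul_of_nonneg_left (h4.trans (by linarith : p x₀ ≤ p x₀ + 1 / 4)) ha.le
        linarith
  · rw [abs_of_nonpos hs] at hrx
    have h3 : C / (μ x₀ * h₂ x₀ * B) < -u x₀ := by simp only [r] at hrx; linarith
    rw [div_lt_iff₀ (by positivity)] at h3
    have h4 : -B * u x₀ ≤ q x₀ := le_exp_mul_exp_sub_one (by nlinarith)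
    calc C < -u x₀ * (μ x₀ * h₂ x₀ * B) := h3
      _ = μ x₀ * (h₂ x₀ * (-B * u x₀)) := by ring
      _ ≤ μ x₀ * (h₁ x₀ * (p x₀ + 1 / 4) + h₂ x₀ * (q x₀ + 1 / 4)) := by
        gcongr
        have := mul_le_mul_of_nonneg_left (h4.trans (by linarith : q x₀ ≤ q x₀ + 1 / 4)) hb.le
        linarith

end Tzitzeica

end

theorem theorem2 {V : Type*} [Fintype V] (G : SimpleGraph V) [DecidableRel G.Adj]
    (hG : G.Connected)
    (μ : V → ℝ) (hμ : ∀ x, 0 < μ x)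
    (w : V → V → ℝ) (hw_pos : ∀ x y, G.Adj x y → 0 < w x y)
    (hw_symm : ∀ x y, G.Adj x y → w x y = w y x)
    (h₁ h₂ : V → ℝ) (hh₁ : ∀ x, 0 < h₁ x) (hh₂ : ∀ x, 0 < h₂ x)
    (A B : ℝ) (hA : 0 < A) (hB : 0 < B) :
    ∃ L : ℝ, ∀ R : ℝ, L < R →
      HasBrouwerDegree (tzitzeicaMap G μ w h₁ h₂ A B) (Metric.ball (0 : V → ℝ) R) 0 0 := by
  obtain ⟨L, hL, hpos⟩ :=
    exists_forall_sum_mul_tzitzeicaMap_pos G hμ hw_symm hh₁ hh₂ hA hB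
  have := hG.nonempty
  refine ⟨L, fun R hR => hasBrouwerDegree_zero_of_pos_on_sphere (contDiff_tzitzeicaMap G)
    (hL.trans_lt hR) (∑ x, μ x • ContinuousLinearMap.proj x) (v := fun _ => 1) ?_
    fun u hu => ?_⟩
  · simpa using Finset.sum_pos (fun x _ => hμ x) Finset.univ_nonempty
  · simpa using hpos u (hu ▸ hR)
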